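/- Let $\pi \in S(n)$ be a permutation of $\{1,\dots,n\}$, and let $\mu \vdash k$ be its reduced cycle type, i.e. the partition obtained by subtracting one from the length of each cycle of $\pi$ (zero parts are discarded). For a finite sequence, call the partition formed by the multiplicities of its distinct values the type of the sequence. A primitive factorization of $\pi$ into $k$ transpositions is a sequence $((s_1,t_1),\dots,(s_k,t_k))$ with $\pi=(s_1\,t_1)\cdots(s_k\,t_k)$, $1\le s_i<t_i\le n$ for all $i$, and $t_1\le\dots\le t_k$; its type is the type of $(t_1,\dots,t_k)$, a partition of $k$. For $m\ge 0$ let $\mathfrak{E}(m)$ be the set of weakly increasing sequences $i_1\le\dots\le i_m$ of positive integers with $i_p\ge p$ for $1\le p\le m-1$ and, if $m\ge1$, $i_m=m$; for $\nu\vdash m$ let the refined Catalan number $\operatorname{RC}(\nu)$ be the number of sequences in $\mathfrak{E}(m)$ of type $\nu$. Write $\mu=(\mu_1\ge\dots\ge\mu_{\ell(\mu)})$ and, for $\lambda\vdash k$, let $\mathfrak{R}(\lambda,\mu)$ be the set of sequences of partitions $(\lambda^{(1)},\dots,\lambda^{(\ell(\mu))})$ with $\lambda^{(i)}\vdash\mu_i$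 for all $i$ and $\lambda^{(1)}\cup\dots\cup\lambda^{(\ell(\mu))}=\lambda$ (union of multisets of parts). Then $k$ is the least length of a factorization of $\pi$ into transpositions, and for every partition $\lambda\vdash k$ the number of primitive factorizations of $\pi$ of type $\lambda$ (all of which are therefore minimal) is $$\sum_{(\lambda^{(1)},\dots,\lambda^{(\ell(\mu))})\in\mathfrak{R}(\lambda,\mu)}\operatorname{RC}(\lambda^{(1)})\cdots\operatorname{RC}(\lambda^{(\ell(\mu))}).$$ -/

import Mathlib

/-- The type of a finite sequence `f` of length `k`: the multiset of the frequencies with which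
the values that occur in `f` occur (values that do not occur are disregarded). -/
def seqType {k : ℕ} {α : Type*} [DecidableEq α] (f : Fin k → α) : Multiset ℕ :=
  (Finset.univ.image f).val.map fun a => (Finset.univ.filter fun p : Fin k => f p = a).card

/-- The set of weakly increasing sequences `i_1 ≤ ⋯ ≤ i_k` of `k` positive integers with
`i_p ≥ p` for `1 ≤ p ≤ k - 1` and `i_k = k`. The entry `i_p` is `f ⟨p - 1, _⟩`. -/
def catalanSeqs (k : ℕ) : Set (Fin k → ℕ) :=
  {f | Monotone f ∧ (∀ p, 0 < f p) ∧
    (∀ p : Fin k, (p : ℕ) + 1 < k → (p : ℕ) + 1 ≤ f p) ∧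
    (∀ p : Fin k, (p : ℕ) + 1 = k → f p = k)}

/-- There are finitely many such sequences, so that the cardinality below is the true one. -/
theorem catalanSeqs_finite (k : ℕ) : (catalanSeqs k).Finite := by
  refine (Set.finite_Iic (fun _ : Fin k => k)).subset ?_
  rintro f ⟨hmono, -, -, hlast⟩ p
  have hk : k - 1 < k := Nat.sub_lt (by have := p.isLt; omega) one_pos
  have hp : p ≤ ⟨k - 1, hk⟩ := by
    rw [Fin.le_def]
    have := p.isLt
    simp only
    omega
  have h := hlast ⟨k - 1, hk⟩ (by simp only; omega)
  exact (hmono hp).trans h.le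

/-- The refined Catalan number of the partition `lam` of `k`. -/
noncomputable def refinedCatalan {k : ℕ} (lam : k.Partition) : ℕ :=
  {f ∈ catalanSeqs k | seqType f = lam.parts}.ncard

/-- The parts of a partition in weakly decreasing order. -/
def sortedParts {k : ℕ} (mu : k.Partition) : List ℕ :=
  mu.parts.sort (· ≥ ·)

/-- The sequences `(λ^{(1)}, …, λ^{(ℓ(μ))})` of partitions `λ^{(i)}` of `μ_i` whose union, as
multisets of parts, is `lam`. -/
def refinements {k : ℕ} (lam mu : k.Partition) :
    Finset ((i : Fin (sortedParts mu).length) → ((sortedParts mu).get i).Partition) :=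
  Finset.univ.filter fun nu => ∑ i, (nu i).parts = lam.parts

/-- The reduced cycle type of a permutation: one is subtracted from the length of each cycle.
`Equiv.Perm.cycleType` lists the lengths of the cycles of length at least two; fixed points
would contribute parts equal to zero. -/
def reducedCycleType {n : ℕ} (π : Equiv.Perm (Fin n)) : Multiset ℕ :=
  π.cycleType.map fun c => c - 1

/-- `f = ((s_1, t_1), …, (s_k, t_k))` is a primitive factorization of `π`:
`π = (s_1 t_1) ⋯ (s_k t_k)` with `s_i < t_i` for all `i` and `t_1 ≤ ⋯ ≤ t_k`. -/
def IsPrimitiveFactorization {n k : ℕ} (π : Equiv.Perm (Fin n)) (f : Fin k → Fin n × Fin n) :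
    Prop :=
  (∀ i, (f i).1 < (f i).2) ∧ (Monotone fun i => (f i).2) ∧
    (List.ofFn fun i => Equiv.swap (f i).1 (f i).2).prod = π

/-- The set of primitive factorizations of `π` of type `lam`, where the type records how often
each point occurs as the larger element of a factor. -/
def primitiveFactorizations {n k : ℕ} (π : Equiv.Perm (Fin n)) (lam : k.Partition) :
    Set (Fin k → Fin n × Fin n) :=
  {f | IsPrimitiveFactorization π f ∧ seqType (fun i => (f i).2) = lam.parts}

/-- The numbers `m` such that `π` is a product of `m` transpositions. -/
def factorizationLengths {n : ℕ} (π : Equiv.Perm (Fin n)) : Set ℕ :=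
  {m | ∃ l : List (Equiv.Perm (Fin n)), l.length = m ∧ (∀ τ ∈ l, τ.IsSwap) ∧ l.prod = π}

/-! Give a sequence of weakly increasing levels the weight `∏ p c`, where `c` runs over the numbers
of entries of each level and `p 0 = 1`. The level of a factor `(s t)` with `s < t` is `t`. Both
sides then count plane trees in which a vertex with `i` children weighs `p i`.

For factorizations (`levelSum_factorization`), let `v` be the largest level allowed. In a
factorization of minimal length, a last factor `(s v)` must cut the cycle of `v` in two: a cycle
avoiding `v`, and a shorter cycle through `v`. The same recursion governs trees when the first
subtree of the root is detached (`treeWeight_succ`). So the minimal primitive factorizations of `π`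
have total weight the product, over its cycles, of the weights of trees with one edge fewer than the
length of the cycle.

For Catalan sequences (`levelSum_catalan`), the multiplicities read from the largest value down are
the child counts of a tree, as in Łukasiewicz words. Thus the sequences in `catalanSeqs m` weigh as
much as the trees with `m` edges. With independent variables for the `p i`, the weight records the
type, and comparing coefficients gives the formula. -/

/-! ### Weighted plane forests and trees -/

open Finset in
/-- The weighted number of plane forests with `q` trees and `m` vertices, where a vertex with `i`
children has weight `p i`. -/
def forestWeight {R : Type*} [CommSemiring R] (p : ℕ → R) : ℕ → ℕ → R
  | q, 0 => if q = 0 then 1 else 0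
  | 0, _ + 1 => 0
  -- Deleting the first root turns its `i` children into roots. Values `i > m` would leave more
  -- trees than vertices.
  | q + 1, m + 1 => ∑ i ∈ range (m + 1), p i * forestWeight p (q + i) m

section Forest

open Finset

variable {R : Type*} [CommSemiring R] (p : ℕ → R)

theorem forestWeight_zero_right (q : ℕ) : forestWeight p q 0 = if q = 0 then 1 else 0 := by
  cases q <;> rfl

theorem forestWeight_zero_left (m : ℕ) : forestWeight p 0 m = if m = 0 then 1 else 0 := by
  cases m <;> rfl

theorem forestWeight_succ_succ (q m : ℕ) :
    forestWeight p (q + 1) (m + 1) = ∑ i ∈ range (m + 1), p i * forestWeight p (q + i) m := rfl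

theorem forestWeight_eq_zero {q m : ℕ} (h : m < q) : forestWeight p q m = 0 := by
  induction m generalizing q with
  | zero => rw [forestWeight_zero_right, if_neg (by omega)]
  | succ m ih =>
    obtain ⟨q, rfl⟩ : ∃ q', q = q' + 1 := ⟨q - 1, by omega⟩
    rw [forestWeight_succ_succ]
    exact sum_eq_zero fun i _ => by rw [ih (by omega), mul_zero]

theorem forestWeight_succ_of_le {q m N : ℕ} (h : m + 1 ≤ N) :
    forestWeight p (q + 1) (m + 1) = ∑ i ∈ range N, p i * forestWeight p (q + i) m := by
  rw [forestWeight_succ_succ]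
  refine sum_subset (range_mono h) fun i _ hi => ?_
  rw [mem_range] at hi
  rw [forestWeight_eq_zero p (by omega), mul_zero]

theorem forestWeight_add (a b m : ℕ) :
    forestWeight p (a + b) m =
      ∑ ij ∈ antidiagonal m, forestWeight p a ij.1 * forestWeight p b ij.2 := by
  induction m generalizing a b with
  | zero => cases a <;> cases b <;> simp [forestWeight_zero_right]
  | succ m ih =>
    cases a with
    | zero =>
      rw [Nat.sum_antidiagonal_succ, sum_eq_zero]
      · simp [forestWeight_zero_left]
      · simp [forestWeight_zero_left]
    | succ a =>
      rw [Nat.sum_antidiagonal_succ, forestWeight_zero_right, if_neg (by omega), zero_mul,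
        zero_add, show a + 1 + b = (a + b) + 1 by omega, forestWeight_succ_succ]
      have h : ∀ ij ∈ antidiagonal m, forestWeight p (a + 1) (ij.1 + 1) * forestWeight p b ij.2 =
          ∑ i ∈ range (m + 1),
            p i * (forestWeight p (a + i) ij.1 * forestWeight p b ij.2) := by
        intro ij hij
        have := mem_antidiagonal.1 hij
        rw [forestWeight_succ_of_le p (show ij.1 + 1 ≤ m + 1 by omega), sum_mul]
        exact sum_congr rfl fun i _ => mul_assoc _ _ _
      rw [sum_congr rfl h, sum_comm]
      refine sum_congr rfl fun i _ => ?_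
      rw [show a + b + i = a + i + b by omega, ih, mul_sum]

/-- The weighted number of plane trees with `m` edges, where `r` is added to the number of children
of the root. -/
def treeWeight (r m : ℕ) : R := ∑ q ∈ range (m + 1), p (r + q) * forestWeight p q m

theorem treeWeight_zero (r : ℕ) : treeWeight p r 0 = p r := by
  simp [treeWeight, forestWeight_zero_right]

theorem treeWeight_zero_left (m : ℕ) : treeWeight p 0 m = forestWeight p 1 (m + 1) := by
  rw [treeWeight, ← zero_add 1, forestWeight_succ_succ]
  simp

/-- Detach the first subtree of the root, with `j` edges, together with the edge leading to it. The
shift `r + 1` remembers the lost child. -/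
theorem treeWeight_succ (r m : ℕ) :
    treeWeight p r (m + 1) =
      ∑ j ∈ range (m + 1), treeWeight p 0 j * treeWeight p (r + 1) (m - j) := by
  have h (q : ℕ) : forestWeight p (q + 1) (m + 1) =
      ∑ j ∈ range (m + 1), treeWeight p 0 j * forestWeight p q (m - j) := by
    rw [add_comm q, forestWeight_add, Nat.sum_antidiagonal_succ, forestWeight_zero_right,
      if_neg (by omega), zero_mul, zero_add, Nat.sum_antidiagonal_eq_sum_range_succ_mk]
    exact sum_congr rfl fun j _ => by rw [treeWeight_zero_left]
  rw [treeWeight, sum_range_succ', forestWeight_zero_left, if_neg (by omega), mul_zero, add_zero]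
  simp_rw [h, mul_sum]
  rw [sum_comm]
  refine sum_congr rfl fun j _ => ?_
  rw [treeWeight.eq_def p (r + 1), mul_sum]
  symm
  refine (sum_subset (range_mono (show m - j + 1 ≤ m + 1 by omega)) fun q _ hq => ?_).trans
    (sum_congr rfl fun q _ => ?_)
  · rw [mem_range] at hq
    rw [forestWeight_eq_zero p (by omega), mul_zero, mul_zero]
  · rw [show r + 1 + q = r + (q + 1) by omega]
    ring

end Forest

/-! ### Weighted sums over sequences of increasing level -/

section Levels

open Finset
open scoped Classical

variable {R ι : Type*} [CommSemiring R] (p : ℕ → R) (t : ι → ℕ)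

/-- The number of indices at which the sequence `f` has level `u`. -/
def levelCount {k : ℕ} (f : Fin k → ι) (u : ℕ) : ℕ := #{i | t (f i) = u}

theorem levelCount_eq_zero {k v : ℕ} {f : Fin k → ι} (h : ∀ i, t (f i) < v) :
    levelCount t f v = 0 := by
  rw [levelCount, card_eq_zero, filter_eq_empty_iff]
  exact fun i _ => (h i).ne

theorem levelCount_snoc {k : ℕ} (f : Fin k → ι) (x : ι) (u : ℕ) :
    levelCount t (Fin.snoc f x : Fin (k + 1) → ι) u =
      levelCount t f u + if t x = u then 1 else 0 := by
  simp only [levelCount, card_filter, Fin.sum_univ_castSucc, Fin.snoc_castSucc, Fin.snoc_last]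

theorem monotone_comp_snoc {k : ℕ} (f : Fin k → ι) (x : ι) :
    Monotone (t ∘ (Fin.snoc f x : Fin (k + 1) → ι)) ↔
      Monotone (t ∘ f) ∧ ∀ i, t (f i) ≤ t x := by
  constructor
  · intro h
    refine ⟨fun i j hij => ?_, fun i => ?_⟩
    · simpa using h (Fin.castSucc_le_castSucc_iff.2 hij)
    · simpa using h (Fin.le_last i.castSucc)
  · rintro ⟨h1, h2⟩ i j hij
    induction j using Fin.lastCases with
    | last => induction i using Fin.lastCases with
      | last => exact le_rfl
      | cast i => simpa using h2 i
    | cast j => induction i using Fin.lastCases with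
      | last => exact absurd (hij.trans_lt (Fin.castSucc_lt_last j)) (lt_irrefl _)
      | cast i => simpa using h1 (Fin.castSucc_le_castSucc_iff.1 hij)

variable [Fintype ι]

/-- The weighted number of sequences of weakly increasing level below `v` that satisfy `Q`. -/
noncomputable def levelSum {k : ℕ} (Q : (Fin k → ι) → Prop) (v : ℕ) : R :=
  ∑ f with Monotone (t ∘ f) ∧ (∀ i, t (f i) < v) ∧ Q f, ∏ u ∈ range v, p (levelCount t f u)

/-- The weighted number of sequences of weakly increasing level at most `v` that satisfy `Q`,
where `r` is added to the number of entries of level `v`. -/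
noncomputable def shiftedLevelSum {k : ℕ} (Q : (Fin k → ι) → Prop) (v r : ℕ) : R :=
  ∑ f with Monotone (t ∘ f) ∧ (∀ i, t (f i) < v + 1) ∧ Q f,
    (∏ u ∈ range v, p (levelCount t f u)) * p (r + levelCount t f v)

theorem levelSum_succ {k : ℕ} (Q : (Fin k → ι) → Prop) (v : ℕ) :
    levelSum p t Q (v + 1) = shiftedLevelSum p t Q v 0 := by
  simp [levelSum, shiftedLevelSum, prod_range_succ]

theorem shiftedLevelSum_eq_zero {k : ℕ} {Q : (Fin k → ι) → Prop} (v r : ℕ) (h : ∀ f, ¬ Q f) :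
    shiftedLevelSum p t Q v r = 0 := by
  simp [shiftedLevelSum, h]

theorem levelSum_eq_zero {k : ℕ} {Q : (Fin k → ι) → Prop} (v : ℕ)
    (h : ∀ f, (∀ i, t (f i) < v) → ¬ Q f) :
    levelSum p t Q v = 0 := by
  rw [levelSum, filter_eq_empty_iff.2, sum_empty]
  rintro f - ⟨-, h1, h2⟩
  exact h f h1 h2

theorem levelSum_length_zero (hp : p 0 = 1) (Q : (Fin 0 → ι) → Prop) (v : ℕ) :
    levelSum p t Q v = if Q Fin.elim0 then 1 else 0 := by
  have h : ∀ f : Fin 0 → ι, f = Fin.elim0 := fun f => Subsingleton.elim _ _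
  have hm : Monotone (t ∘ (Fin.elim0 : Fin 0 → ι)) := fun i => i.elim0
  rw [levelSum, sum_filter, Fintype.sum_subsingleton _ Fin.elim0]
  simp [hm, levelCount, hp]

theorem shiftedLevelSum_length_zero {Q : (Fin 0 → ι) → Prop} (v r : ℕ) :
    shiftedLevelSum p t Q v r = p r * levelSum p t Q v := by
  rw [shiftedLevelSum, levelSum, mul_sum]
  refine sum_congr ?_ fun f _ => ?_
  · ext f; simp
  · rw [levelCount_eq_zero t (fun i => i.elim0), add_zero, mul_comm]

/-- If the last entry has level below `v`, so do all entries, by monotonicity. Otherwise it is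
stripped off and remembered in `r`. -/
theorem shiftedLevelSum_length_succ {k : ℕ} (Q : (Fin (k + 1) → ι) → Prop) (v r : ℕ) :
    shiftedLevelSum p t Q v r = p r * levelSum p t Q v +
      ∑ x with t x = v, shiftedLevelSum p t (fun f : Fin k → ι => Q (Fin.snoc f x)) v (r + 1) := by
  rw [shiftedLevelSum, ← sum_filter_not_add_sum_filter _ (fun f => t (f (Fin.last k)) = v)]
  congr 1
  · rw [levelSum, mul_sum, filter_filter]
    refine sum_congr ?_ fun f hf => ?_
    · refine filter_congr fun f _ => ⟨?_, ?_⟩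
      · rintro ⟨⟨h1, h2, h3⟩, h4⟩
        refine ⟨h1, fun i => ?_, h3⟩
        have := h2 (Fin.last k)
        have : t (f i) ≤ t (f (Fin.last k)) := h1 (Fin.le_last i)
        omega
      · rintro ⟨h1, h2, h3⟩
        exact ⟨⟨h1, fun i => (h2 i).trans (Nat.lt_succ_self v), h3⟩, (h2 _).ne⟩
    · rw [levelCount_eq_zero t (mem_filter.1 hf).2.2.1, add_zero, mul_comm]
  · rw [filter_filter, sum_filter, ← (Fin.snocEquiv fun _ : Fin (k + 1) => ι).sum_comp,
      Fintype.sum_prod_type, sum_filter]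
    refine sum_congr rfl fun x _ => ?_
    split_ifs with hx
    · rw [shiftedLevelSum, sum_filter]
      refine sum_congr rfl fun f _ => ?_
      simp only [Fin.snocEquiv, Equiv.coe_fn_mk, Fin.snoc_last]
      refine if_congr ?_ ?_ rfl
      · rw [monotone_comp_snoc]
        simp only [Fin.forall_fin_succ', Fin.snoc_castSucc, Fin.snoc_last, hx]
        constructor
        · tauto
        · rintro ⟨h1, h2, h3⟩
          exact ⟨⟨⟨h1, fun i => Nat.lt_succ_iff.1 (h2 i)⟩, ⟨h2, by omega⟩, h3⟩, trivial⟩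
      · rw [levelCount_snoc, if_pos hx]
        congr 1
        · refine prod_congr rfl fun u hu => ?_
          rw [levelCount_snoc, if_neg (by have := mem_range.1 hu; omega), add_zero]
        · congr 1; omega
    · refine sum_eq_zero fun f _ => if_neg ?_
      simp [Fin.snocEquiv, hx]

end Levels

/-! ### Cycles, transpositions and reduced length -/

section Permutations

open Equiv Equiv.Perm

variable {α : Type*} [DecidableEq α]

theorem formPerm_append_mul_formPerm_cons (l₁ l₂ : List α) (a : α) :
    (l₁ ++ [a]).formPerm * (a :: l₂).formPerm = (l₁ ++ a :: l₂).formPerm := by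
  induction l₁ with
  | nil => simp
  | cons x l ih =>
    cases l with
    | nil => simp
    | cons y l =>
      simp only [List.cons_append, List.formPerm_cons_cons, mul_assoc] at ih ⊢
      rw [ih]

theorem formPerm_concat_eq_formPerm_cons {l : List α} {a : α} (h : (a :: l).Nodup) :
    (l ++ [a]).formPerm = (a :: l).formPerm := by
  rw [← List.formPerm_rotate_one _ h]
  simp

theorem formPerm_map (σ : Perm α) (l : List α) :
    (l.map σ).formPerm = σ * l.formPerm * σ⁻¹ := by
  induction l with
  | nil => simp
  | cons x l ih =>
    cases l with
    | nil => simp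
    | cons y l =>
      simp only [List.map_cons, List.formPerm_cons_cons] at ih ⊢
      rw [ih, swap_apply_apply]
      group

/-- Split the cycle at `a` and rotate the first piece so that it ends in `swap a b`. Conjugation by
this transposition turns the cycle of `a :: l₂` into that of `b :: l₂`. -/
theorem formPerm_mul_swap {l₁ l₂ : List α} {a b : α} (h : (b :: (l₁ ++ a :: l₂)).Nodup) :
    (b :: (l₁ ++ a :: l₂)).formPerm * swap a b =
      (l₁ ++ [a]).formPerm * (b :: l₂).formPerm := by
  have h₁ : (b :: (l₁ ++ [a])).Nodup := h.sublist (by simp)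
  have h₂ : (a :: l₂).map (swap a b) = b :: l₂ := by
    simp only [List.map_cons, swap_apply_left, List.cons.injEq, true_and]
    refine (List.map_congr_left fun x hx => swap_apply_of_ne_of_ne ?_ ?_).trans (List.map_id _)
    · rintro rfl
      simp [List.nodup_append, hx] at h
    · rintro rfl
      simp [hx] at h
  rw [← List.cons_append, ← formPerm_append_mul_formPerm_cons, List.cons_append,
    ← formPerm_concat_eq_formPerm_cons h₁, List.append_assoc, List.singleton_append,
    List.formPerm_append_pair, ← h₂, formPerm_map]
  simp [mul_assoc]

theorem disjoint_formPerm {l : List α} {ρ : Perm α} (h : ∀ x ∈ l, ρ x = x) :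
    Disjoint l.formPerm ρ := by
  intro x
  by_cases hx : x ∈ l
  · exact Or.inr (h x hx)
  · exact Or.inl (List.formPerm_apply_of_notMem hx)

theorem apply_ne_of_mem {a : α} {l : List α} (hl : (a :: l).Nodup) {ρ : Perm α}
    (h : ∀ x ∈ a :: l, ρ x = x) (h' : l ≠ []) {x : α} (hx : x ∈ a :: l) :
    ((a :: l).formPerm * ρ) x ≠ x := by
  rw [Perm.mul_apply, h x hx, List.formPerm_apply_mem_ne_self_iff _ hl _ hx]
  have := List.length_pos_iff.2 h'
  simp only [List.length_cons]
  omega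

theorem formPerm_mul_mul_swap {l₁ l₂ : List α} {a b : α} {ρ : Perm α}
    (hl : (b :: (l₁ ++ a :: l₂)).Nodup) (h : ∀ x ∈ b :: (l₁ ++ a :: l₂), ρ x = x) :
    (b :: (l₁ ++ a :: l₂)).formPerm * ρ * swap a b =
      (b :: l₂).formPerm * ((a :: l₁).formPerm * ρ) := by
  have h₁ : (a :: l₁).Nodup := by
    have : (l₁ ++ [a]).Nodup := hl.sublist (by simp)
    exact (List.perm_append_singleton a l₁).nodup_iff.1 this
  have hs : Disjoint (swap a b) ρ := by
    have := disjoint_formPerm (l := [a, b]) (ρ := ρ) (fun x hx => h x (by simp at hx ⊢; tauto))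
    simpa using this
  have hd : Disjoint (a :: l₁).formPerm (b :: l₂).formPerm := by
    refine disjoint_formPerm fun x hx => List.formPerm_apply_of_notMem fun hx' => ?_
    simp only [List.nodup_cons, List.nodup_append, List.mem_append, List.mem_cons] at hl hx hx'
    grind
  rw [mul_assoc, ← hs.commute.eq, ← mul_assoc, formPerm_mul_swap hl,
    formPerm_concat_eq_formPerm_cons h₁, hd.commute.eq, mul_assoc]

variable [Fintype α]

/-- The product of the weights `C m`, where `m + 1` runs over the cycle lengths of `π`. -/
def cycleWeight {R : Type*} [CommMonoid R] (C : ℕ → R) (π : Perm α) : R :=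
  (π.cycleType.map fun c => C (c - 1)).prod

/-- The sum of the reduced cycle lengths of `π`. -/
def reducedLength (π : Perm α) : ℕ := (π.cycleType.map fun c => c - 1).sum

theorem cycleWeight_one {R : Type*} [CommMonoid R] (C : ℕ → R) :
    cycleWeight C (1 : Perm α) = 1 := by
  simp [cycleWeight]

theorem cycleWeight_formPerm_mul {R : Type*} [CommMonoid R] {C : ℕ → R} (hC : C 0 = 1)
    {a : α} {l : List α} (hl : (a :: l).Nodup) {ρ : Perm α} (h : ∀ x ∈ a :: l, ρ x = x) :
    cycleWeight C ((a :: l).formPerm * ρ) = C l.length * cycleWeight C ρ := by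
  rw [cycleWeight, (disjoint_formPerm h).cycleType_mul, Multiset.map_add, Multiset.prod_add]
  congr 1
  cases l with
  -- A fixed point does not appear in `cycleType`, so its weight `C 0` must be one.
  | nil => simp [hC]
  | cons b l =>
    rw [(List.isCycle_formPerm hl (by simp)).cycleType,
      List.support_formPerm_of_nodup _ hl (by simp), List.toFinset_card_of_nodup hl]
    simp

/-- This makes additivity of the reduced length a case of the multiplicativity of `cycleWeight`. -/
theorem reducedLength_eq (π : Perm α) :
    Multiplicative.ofAdd (reducedLength π) = cycleWeight Multiplicative.ofAdd π := by
  rw [reducedLength, cycleWeight, ofAdd_multiset_prod, Multiset.map_map]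
  rfl

theorem reducedLength_one : reducedLength (1 : Perm α) = 0 := by
  simp [reducedLength]

theorem reducedLength_formPerm_mul {a : α} {l : List α} (hl : (a :: l).Nodup) {ρ : Perm α}
    (h : ∀ x ∈ a :: l, ρ x = x) :
    reducedLength ((a :: l).formPerm * ρ) = l.length + reducedLength ρ := by
  apply Multiplicative.ofAdd.injective
  rw [ofAdd_add, reducedLength_eq, reducedLength_eq, cycleWeight_formPerm_mul rfl hl h]

theorem reducedLength_eq_zero {π : Perm α} : reducedLength π = 0 ↔ π = 1 := by
  refine ⟨fun h => ?_, fun h => h ▸ reducedLength_one⟩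
  rw [← cycleType_eq_zero, Multiset.eq_zero_iff_forall_notMem]
  intro c hc
  have h₁ := two_le_of_mem_cycleType hc
  have h₂ := Multiset.sum_eq_zero_iff.1 h (c - 1) (Multiset.mem_map_of_mem _ hc)
  omega

/-- A permutation is the product of the cycle through a given point and a permutation that fixes
the points of that cycle. -/
theorem exists_eq_formPerm_mul (π : Perm α) (a : α) :
    ∃ (l : List α) (ρ : Perm α), (a :: l).Nodup ∧ (∀ x ∈ a :: l, ρ x = x) ∧
      π = (a :: l).formPerm * ρ := by
  by_cases ha : π a = a
  · exact ⟨[], π, by simp, by simpa using ha, by simp⟩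
  · have hs : a ∈ π.support := mem_support.2 ha
    have hlen := length_toList_pos_of_mem_support π a hs
    have h0 := toList_getElem_zero π a hs
    obtain ⟨b, l, hl⟩ := List.exists_cons_of_length_pos hlen
    obtain rfl : b = a := by simpa [hl] using h0
    refine ⟨l, (π.cycleOf b)⁻¹ * π, hl ▸ nodup_toList π b, fun x hx => ?_, ?_⟩
    · rw [← hl, mem_toList_iff] at hx
      rw [Perm.mul_apply, Perm.inv_eq_iff_eq, hx.1.cycleOf_apply]
    · rw [← hl, formPerm_toList, mul_inv_cancel_left]

theorem reducedLength_mul_swap_of_mem {a b : α} {l : List α} {ρ : Perm α}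
    (hl : (b :: l).Nodup) (h : ∀ x ∈ b :: l, ρ x = x) (ha : a ∈ l) :
    reducedLength ((b :: l).formPerm * ρ) =
      reducedLength ((b :: l).formPerm * ρ * swap a b) + 1 := by
  obtain ⟨l₁, l₂, rfl⟩ := List.append_of_mem ha
  have hd : ∀ x ∈ b :: l₂, x ∉ a :: l₁ := by
    simp only [List.nodup_cons, List.nodup_append, List.mem_append, List.mem_cons] at hl ⊢
    grind
  rw [formPerm_mul_mul_swap hl h, reducedLength_formPerm_mul hl h,
    reducedLength_formPerm_mul (hl.sublist (by simp)), reducedLength_formPerm_mul]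
  · simp only [List.length_append, List.length_cons]; omega
  · have : (l₁ ++ [a]).Nodup := hl.sublist (by simp)
    exact (List.perm_append_singleton a l₁).nodup_iff.1 this
  · exact fun x hx => h x (by simp at hx ⊢; tauto)
  · intro x hx
    rw [Perm.mul_apply, h x (by simp at hx ⊢; tauto), List.formPerm_apply_of_notMem (hd x hx)]

/-- Joining two cycles is inverse to cutting one: the joined cycle, cut by the same transposition,
gives back the original permutation. -/
theorem reducedLength_mul_swap_of_notMem {a b : α} {l : List α} {ρ : Perm α}
    (hl : (b :: l).Nodup) (h : ∀ x ∈ b :: l, ρ x = x) (ha : a ∉ b :: l) :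
    reducedLength ((b :: l).formPerm * ρ * swap a b) =
      reducedLength ((b :: l).formPerm * ρ) + 1 := by
  obtain ⟨l', σ, hl', hσ, rfl⟩ := exists_eq_formPerm_mul ρ a
  have hd : ∀ x ∈ b :: l, x ∉ a :: l' := by
    intro x hx hx'
    by_cases h0 : l' = []
    · subst h0
      simp only [List.mem_singleton] at hx'
      exact ha (hx' ▸ hx)
    -- A nontrivial cycle of `a` moves all its points, whereas the points of `b :: l` are fixed.
    · exact apply_ne_of_mem hl' hσ h0 hx' (h x hx)
  have hσ' : ∀ x ∈ b :: (l' ++ a :: l), σ x = x := by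
    intro x hx
    by_cases hx' : x ∈ a :: l'
    · exact hσ x hx'
    · have hx'' : x ∈ b :: l := by simp at hx hx' ⊢; tauto
      have hs : σ x = (a :: l').formPerm⁻¹ x := by
        rw [eq_inv_iff_eq]
        exact h x hx''
      rw [hs, inv_eq_iff_eq, List.formPerm_apply_of_notMem hx']
  have hn : (b :: (l' ++ a :: l)).Nodup := by
    simp only [List.nodup_cons, List.nodup_append, List.mem_append, List.mem_cons] at *
    grind
  have key := formPerm_mul_mul_swap hn hσ'
  rw [← key, mul_assoc _ (swap a b), swap_mul_self, mul_one,
    reducedLength_mul_swap_of_mem hn hσ' (by simp : a ∈ l' ++ a :: l)]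

theorem reducedLength_mul_swap_le {a b : α} (h : a ≠ b) (π : Perm α) :
    reducedLength π ≤ reducedLength (π * swap a b) + 1 := by
  obtain ⟨l, ρ, hl, hρ, rfl⟩ := exists_eq_formPerm_mul π b
  by_cases ha : a ∈ l
  · exact (reducedLength_mul_swap_of_mem hl hρ ha).le
  · rw [reducedLength_mul_swap_of_notMem hl hρ (by simp [h, ha])]
    omega

/-- A transposition lowers the reduced length by at most one, and the identity has reduced length
zero. -/
theorem reducedLength_prod_le {l : List (Perm α)} (h : ∀ τ ∈ l, τ.IsSwap) :
    reducedLength l.prod ≤ l.length := by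
  induction l using List.reverseRecOn with
  | nil => simp [reducedLength_one]
  | append_singleton l τ ih =>
    obtain ⟨a, b, hab, rfl⟩ := h τ (by simp)
    have h₁ := reducedLength_mul_swap_le hab (l ++ [swap a b]).prod
    have h₂ := ih fun σ hσ => h σ (by simp [hσ])
    simp only [List.prod_append, List.prod_singleton, mul_assoc, swap_mul_self, mul_one,
      List.length_append, List.length_singleton] at h₁ ⊢
    omega

theorem exists_swap_factorization (π : Perm α) :
    ∃ l : List (Perm α), l.length = reducedLength π ∧ (∀ τ ∈ l, τ.IsSwap) ∧ l.prod = π := by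
  induction hk : reducedLength π generalizing π with
  | zero => exact ⟨[], rfl, by simp, by rw [reducedLength_eq_zero.1 hk, List.prod_nil]⟩
  | succ k ih =>
    have h1 : π ≠ 1 := fun h => by simp [h, reducedLength_one] at hk
    obtain ⟨b, hb⟩ : ∃ b, π b ≠ b := by
      by_contra! h
      exact h1 (Perm.ext h)
    obtain ⟨l, ρ, hl, hρ, rfl⟩ := exists_eq_formPerm_mul π b
    obtain ⟨a, ha⟩ : ∃ a, a ∈ l := by
      refine List.exists_mem_of_ne_nil _ fun h0 => hb ?_
      subst h0
      simpa using hρ b (by simp)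
    have hab : a ≠ b := fun h => (List.nodup_cons.1 hl).1 (h ▸ ha)
    have hlen := reducedLength_mul_swap_of_mem hl hρ ha
    obtain ⟨L, hL₁, hL₂, hL₃⟩ := ih ((b :: l).formPerm * ρ * swap a b) (by omega)
    refine ⟨L ++ [swap a b], by simp [hL₁], fun τ hτ => ?_, ?_⟩
    · rcases List.mem_append.1 hτ with h | h
      · exact hL₂ τ h
      · rw [List.mem_singleton.1 h]
        exact ⟨a, b, hab, rfl⟩
    · simp [hL₃, mul_assoc]

end Permutations

/-! ### Catalan sequences as forests -/

section CatalanSums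

open Finset

variable {R : Type*} [CommSemiring R] (p : ℕ → R)

theorem forall_succ_le_snoc_iff {M k : ℕ} (f : Fin k → Fin M) (x : Fin M) :
    (∀ i : Fin (k + 1), (i : ℕ) + 1 ≤ (Fin.snoc f x : Fin (k + 1) → Fin M) i) ↔
      k + 1 ≤ (x : ℕ) ∧ ∀ i : Fin k, (i : ℕ) + 1 ≤ f i := by
  simp [Fin.forall_fin_succ', and_comm]

/-- Here `i` is the number of entries equal to `v`. Since `k ≤ v`, these satisfy the lower bound in
any position. -/
theorem shiftedLevelSum_catalan {M v k : ℕ} (hv : v < M) (hk : k ≤ v) (r : ℕ) :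
    shiftedLevelSum p Fin.val (fun f : Fin k → Fin M => ∀ i : Fin k, (i : ℕ) + 1 ≤ f i) v r =
      ∑ i ∈ range (k + 1), p (r + i) *
        levelSum p Fin.val
          (fun f : Fin (k - i) → Fin M => ∀ j : Fin (k - i), (j : ℕ) + 1 ≤ f j) v := by
  induction k generalizing r with
  | zero => simp [shiftedLevelSum_length_zero]
  | succ k ih =>
    rw [shiftedLevelSum_length_succ, sum_range_succ', add_comm,
      show ({x | (x : ℕ) = v} : Finset (Fin M)) = {⟨v, hv⟩} by ext; simp [Fin.ext_iff],
      sum_singleton]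
    congr 1
    simp_rw [forall_succ_le_snoc_iff, hk, true_and]
    rw [ih (by omega)]
    refine sum_congr rfl fun i hi => ?_
    rw [show r + 1 + i = r + (i + 1) by omega, Nat.add_sub_add_right]

/-- The multiplicity of the top value is the child count of the first root; removing that value
removes that root. -/
theorem levelSum_catalan (hp : p 0 = 1) {M v k : ℕ} (hv : v ≤ M) (hk : k ≤ v) :
    levelSum p Fin.val (fun f : Fin k → Fin M => ∀ i : Fin k, (i : ℕ) + 1 ≤ f i) v =
      forestWeight p (v - k) v := by
  induction v generalizing k with
  | zero =>
    obtain rfl : k = 0 := by omega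
    rw [levelSum_length_zero p _ hp]
    simp [forestWeight_zero_left]
  | succ v ih =>
    rcases hk.eq_or_lt with rfl | hk
    -- With `v + 1` entries the last would have to be at least `v + 1`; correspondingly, no forest
    -- without trees has vertices.
    · rw [Nat.sub_self, forestWeight_zero_left, if_neg (by omega)]
      refine levelSum_eq_zero _ _ _ fun f hf h => ?_
      have h₁ := hf (Fin.last v)
      have h₂ := h (Fin.last v)
      rw [Fin.val_last] at h₂
      omega
    · rw [levelSum_succ, shiftedLevelSum_catalan p (by omega) (by omega),
        show v + 1 - k = (v - k) + 1 by omega, forestWeight_succ_succ]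
      refine (sum_subset_zero_on_sdiff (range_mono (by omega)) (fun i hi => ?_)
        fun i hi => ?_)
      · rw [mem_sdiff, mem_range, mem_range] at hi
        rw [forestWeight_eq_zero p (by omega), mul_zero]
      · have := mem_range.1 hi
        rw [ih (by omega) (by omega), zero_add, show v - (k - i) = v - k + i by omega]

end CatalanSums

/-! ### Minimal primitive factorizations as trees -/

section FactorizationSums

open Finset Equiv Equiv.Perm

variable {R : Type*} [CommSemiring R] (p : ℕ → R)

/-- The factors of `f` are transpositions `(s t)` with `s < t` whose product is `π`. -/
def IsOrientedFactorization {n k : ℕ} (π : Perm (Fin n)) (f : Fin k → Fin n × Fin n) : Prop :=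
  (∀ i, (f i).1 < (f i).2) ∧ (List.ofFn fun i => swap (f i).1 (f i).2).prod = π

variable {n : ℕ}

theorem isOrientedFactorization_snoc {k : ℕ} (π : Perm (Fin n)) (f : Fin k → Fin n × Fin n)
    (x : Fin n × Fin n) :
    IsOrientedFactorization π (Fin.snoc f x : Fin (k + 1) → Fin n × Fin n) ↔
      x.1 < x.2 ∧ IsOrientedFactorization (π * swap x.1 x.2) f := by
  simp only [IsOrientedFactorization, Fin.forall_fin_succ', Fin.snoc_castSucc, Fin.snoc_last,
    List.ofFn_succ', List.concat_eq_append, List.prod_append, List.prod_singleton]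
  rw [← eq_mul_inv_iff_mul_eq, swap_inv]
  tauto

theorem IsOrientedFactorization.reducedLength_le {k : ℕ} {π : Perm (Fin n)}
    {f : Fin k → Fin n × Fin n} (h : IsOrientedFactorization π f) : reducedLength π ≤ k := by
  have := reducedLength_prod_le (l := List.ofFn fun i => swap (f i).1 (f i).2) fun τ hτ => by
    obtain ⟨i, rfl⟩ := (List.mem_ofFn' _ _).1 hτ
    exact ⟨_, _, (h.1 i).ne, rfl⟩
  rwa [h.2, List.length_ofFn] at this

theorem IsOrientedFactorization.apply_eq_self {k : ℕ} {π : Perm (Fin n)}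
    {f : Fin k → Fin n × Fin n} (h : IsOrientedFactorization π f) {x : Fin n}
    (hx : ∀ i, (f i).2 < x) : π x = x := by
  rw [← h.2]
  have key : ∀ l : List (Perm (Fin n)), (∀ τ ∈ l, τ x = x) → l.prod x = x := by
    intro l hl
    induction l with
    | nil => rfl
    | cons τ l ih =>
      rw [List.prod_cons, Perm.mul_apply, ih fun σ hσ => hl σ (by simp [hσ]), hl τ (by simp)]
  refine key _ fun τ hτ => ?_
  obtain ⟨i, rfl⟩ := (List.mem_ofFn' _ _).1 hτ
  exact swap_apply_of_ne_of_ne ((h.1 i).trans (hx i)).ne' (hx i).ne'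

theorem shiftedLevelSum_factorization_succ {k : ℕ} (π : Perm (Fin n)) (v : Fin n) (r : ℕ) :
    shiftedLevelSum p (fun x => (x.2 : ℕ))
        (IsOrientedFactorization π : (Fin (k + 1) → Fin n × Fin n) → Prop) v r =
      p r * levelSum p (fun x => (x.2 : ℕ))
        (IsOrientedFactorization π : (Fin (k + 1) → Fin n × Fin n) → Prop) v +
      ∑ s with s < v, shiftedLevelSum p (fun x => (x.2 : ℕ))
        (IsOrientedFactorization (π * swap s v) : (Fin k → Fin n × Fin n) → Prop) v (r + 1) := by
  rw [shiftedLevelSum_length_succ]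
  congr 1
  simp_rw [isOrientedFactorization_snoc]
  rw [sum_filter, sum_filter, Fintype.sum_prod_type]
  refine sum_congr rfl fun s _ => ?_
  rw [sum_eq_single v]
  · rw [if_pos rfl]
    split_ifs with h
    · simp [h]
    · exact shiftedLevelSum_eq_zero _ _ _ _ (by simp [h])
  · intro b _ hb
    rw [if_neg (by simpa [Fin.ext_iff] using hb)]
  · simp

theorem sum_toFinset_eq_sum_range {α M : Type*} [DecidableEq α] [AddCommMonoid M] {l : List α}
    (hl : l.Nodup) (g : α → M) (w : ℕ → M) (h : ∀ l₁ a l₂, l = l₁ ++ a :: l₂ → g a = w l₁.length) :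
    ∑ a ∈ l.toFinset, g a = ∑ j ∈ range l.length, w j := by
  rw [List.sum_toFinset _ hl, ← Fin.sum_univ_eq_sum_range, ← Fin.sum_univ_fun_getElem]
  refine sum_congr rfl fun j _ => ?_
  rw [h (l.take j) l[(j : ℕ)] (l.drop (j + 1)) (by simp)]
  simp

/-- The hypothesis `hlow` is the case of levels below `v`. The list `l` is what remains of the cycle
of `v` after `r` factors of level `v` have been stripped off. -/
theorem shiftedLevelSum_factorization {v : Fin n}
    (hlow : ∀ (k : ℕ) (π : Perm (Fin n)), (∀ x, v ≤ x → π x = x) → reducedLength π = k →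
      levelSum p (fun x => (x.2 : ℕ))
        (IsOrientedFactorization π : (Fin k → Fin n × Fin n) → Prop) v =
        cycleWeight (treeWeight p 0) π)
    (hp : p 0 = 1) {k : ℕ} (r : ℕ) {l : List (Fin n)} {ρ : Perm (Fin n)} (hl : (v :: l).Nodup)
    (hρ : ∀ x ∈ v :: l, ρ x = x) (hlt : ∀ x ∈ l, x < v) (hρv : ∀ x, v ≤ x → ρ x = x)
    (hk : l.length + reducedLength ρ = k) :
    shiftedLevelSum p (fun x => (x.2 : ℕ))
        (IsOrientedFactorization ((v :: l).formPerm * ρ) : (Fin k → Fin n × Fin n) → Prop) v r =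
      treeWeight p r l.length * cycleWeight (treeWeight p 0) ρ := by
  have hC : treeWeight p 0 0 = 1 := by rw [treeWeight_zero, hp]
  induction k generalizing r l ρ with
  | zero =>
    obtain rfl : l = [] := List.length_eq_zero_iff.1 (by omega)
    rw [shiftedLevelSum_length_zero, List.length_nil, treeWeight_zero, List.formPerm_singleton,
      one_mul, hlow _ _ hρv (by omega)]
  | succ k ih =>
    rw [shiftedLevelSum_factorization_succ]
    -- Joining another cycle to that of `v` raises the reduced length to `k + 2`, too much for the
    -- `k` remaining factors.
    have hout : ∀ s, s ≠ v → s ∉ l → shiftedLevelSum p (fun x => (x.2 : ℕ))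
        (IsOrientedFactorization ((v :: l).formPerm * ρ * swap s v) :
          (Fin k → Fin n × Fin n) → Prop) v (r + 1) = 0 := by
      intro s hs hsl
      refine shiftedLevelSum_eq_zero _ _ _ _ fun f hf => ?_
      have h₁ := hf.reducedLength_le
      rw [reducedLength_mul_swap_of_notMem hl hρ (by simp [hs, hsl]),
        reducedLength_formPerm_mul hl hρ] at h₁
      omega
    rw [← sum_subset (s₁ := l.toFinset) (fun s hs => by simpa using hlt s (by simpa using hs))
      (fun s hs hs' => hout s (mem_filter.1 hs).2.ne (by simpa using hs'))]
    cases l with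
    | nil =>
      rw [List.formPerm_singleton, one_mul, hlow _ _ hρv (by simpa using hk)]
      simp [treeWeight_zero]
    | cons c l =>
      -- The point `v` is still moved, so factors of level below `v` cannot suffice.
      rw [levelSum_eq_zero, mul_zero, zero_add, List.length_cons, treeWeight_succ, sum_mul,
        ← List.length_cons (a := c)]
      · refine sum_toFinset_eq_sum_range (List.nodup_cons.1 hl).2 _ _ fun l₁ a l₂ h => ?_
        have hlen : l.length + 1 = l₁.length + (l₂.length + 1) := by
          simpa using congrArg List.length h
        rw [h] at hl hρ hlt ⊢
        have hl₁ : (a :: l₁).Nodup := by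
          have : (l₁ ++ [a]).Nodup := hl.sublist (by simp)
          exact (List.perm_append_singleton a l₁).nodup_iff.1 this
        have hd : ∀ x ∈ v :: l₂, x ∉ a :: l₁ := by
          simp only [List.nodup_cons, List.nodup_append, List.mem_append, List.mem_cons] at hl ⊢
          grind
        have hρ₁ : ∀ x ∈ a :: l₁, ρ x = x := fun x hx => hρ x (by simp at hx ⊢; tauto)
        -- The severed cycle of `a :: l₁` joins `ρ` and corresponds to the detached subtree, with
        -- `l₁.length` edges.
        rw [formPerm_mul_mul_swap hl hρ, ih, cycleWeight_formPerm_mul hC hl₁ hρ₁,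
          show l.length - l₁.length = l₂.length by omega]
        · ring
        · exact hl.sublist (by simp)
        · intro x hx
          rw [Perm.mul_apply, hρ x (by simp at hx ⊢; tauto),
            List.formPerm_apply_of_notMem (hd x hx)]
        · exact fun x hx => hlt x (by simp [hx])
        · intro x hx
          rw [Perm.mul_apply, hρv x hx, List.formPerm_apply_of_notMem]
          intro hx'
          exact (hlt x (by simp at hx' ⊢; tauto)).not_ge hx
        · rw [reducedLength_formPerm_mul hl₁ hρ₁]
          rw [List.length_cons] at hk
          omega
      · intro f hf hf'
        exact apply_ne_of_mem hl hρ (by simp) (List.mem_cons_self) (hf'.apply_eq_self hf)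

theorem levelSum_factorization (hp : p 0 = 1) {v k : ℕ} (hv : v ≤ n) {π : Perm (Fin n)}
    (hπ : ∀ x : Fin n, v ≤ x → π x = x) (hk : reducedLength π = k) :
    levelSum p (fun x => (x.2 : ℕ))
        (IsOrientedFactorization π : (Fin k → Fin n × Fin n) → Prop) v =
      cycleWeight (treeWeight p 0) π := by
  induction v generalizing k π with
  | zero =>
    obtain rfl : π = 1 := Perm.ext fun x => hπ x (Nat.zero_le _)
    obtain rfl : k = 0 := by rw [← hk, reducedLength_one]
    rw [levelSum_length_zero p _ hp, cycleWeight_one, if_pos]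
    exact ⟨fun i => i.elim0, by simp⟩
  | succ v ih =>
    have hC : treeWeight p 0 0 = 1 := by rw [treeWeight_zero, hp]
    obtain ⟨l, ρ, hl, hρ, rfl⟩ := exists_eq_formPerm_mul π ⟨v, hv⟩
    have hlt : ∀ x ∈ l, x < ⟨v, hv⟩ := by
      intro x hx
      by_contra! h
      have hne : x ≠ ⟨v, hv⟩ := fun h' => (List.nodup_cons.1 hl).1 (h' ▸ hx)
      refine apply_ne_of_mem hl hρ (List.ne_nil_of_mem hx) (List.mem_cons_of_mem _ hx) (hπ x ?_)
      exact lt_of_le_of_ne h hne.symm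
    have hρv : ∀ x, ⟨v, hv⟩ ≤ x → ρ x = x := by
      intro x hx
      rcases hx.eq_or_lt with rfl | hx
      · exact hρ _ (by simp)
      · have hx' : x ∉ (⟨v, hv⟩ : Fin n) :: l := by
          rintro h
          rcases List.mem_cons.1 h with rfl | h
          · exact lt_irrefl _ hx
          · exact hx.not_gt (hlt x h)
        have hs := hπ x hx
        rw [Perm.mul_apply, ← Perm.eq_inv_iff_eq] at hs
        rw [hs, Perm.inv_eq_iff_eq, List.formPerm_apply_of_notMem hx']
    rw [levelSum_succ, cycleWeight_formPerm_mul hC hl hρ]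
    exact shiftedLevelSum_factorization p (v := ⟨v, hv⟩)
      (fun k σ hσ h => ih (Nat.le_of_succ_le hv) hσ h) hp 0 hl hρ hlt hρv
      (by rw [← hk, reducedLength_formPerm_mul hl hρ])

end FactorizationSums

/-! ### Specialization to types and extraction of coefficients -/

section Types

open Finset

/-- The weight of a number `i > 0` of equal values, as a part of the type of a sequence. -/
noncomputable def partWeight (i : ℕ) : AddMonoidAlgebra ℕ (Multiset ℕ) :=
  if i = 0 then 1 else AddMonoidAlgebra.single {i} 1

theorem partWeight_zero : partWeight 0 = 1 := if_pos rfl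

theorem zero_notMem_seqType {k : ℕ} {α : Type*} [DecidableEq α] (f : Fin k → α) :
    0 ∉ seqType f := by
  simp only [seqType, Multiset.mem_map, not_exists, not_and, card_eq_zero]
  intro a ha h
  obtain ⟨i, -, rfl⟩ := mem_image.1 (show a ∈ univ.image f from ha)
  exact notMem_empty i (h ▸ mem_filter.2 ⟨mem_univ i, rfl⟩)

theorem sum_seqType {k : ℕ} {α : Type*} [DecidableEq α] (f : Fin k → α) :
    (seqType f).sum = k := by
  have h := card_eq_sum_card_image f (univ : Finset (Fin k))
  rw [card_univ, Fintype.card_fin] at h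
  exact h.symm

/-- Levels that are not attained contribute `partWeight 0 = 1`; each other level contributes the
variable of its multiplicity. -/
theorem prod_partWeight_levelCount {ι α : Type*} [DecidableEq α] {k N : ℕ} (t : ι → ℕ)
    (g : ι → α) {e : α → ℕ} (he : Function.Injective e) (ht : ∀ x, t x = e (g x))
    (f : Fin k → ι) (hf : ∀ i, t (f i) < N) :
    ∏ u ∈ range N, partWeight (levelCount t f u) =
      AddMonoidAlgebra.single (seqType (g ∘ f)) 1 := by
  have hsub : (univ.image (g ∘ f)).image e ⊆ range N := by
    intro u hu
    simp only [mem_image, mem_univ, true_and, exists_exists_eq_and, Function.comp_apply] at hu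
    obtain ⟨i, rfl⟩ := hu
    exact mem_range.2 (ht (f i) ▸ hf i)
  rw [← prod_subset hsub fun u _ hu => ?_, prod_image he.injOn]
  · have h (a : α) (ha : a ∈ univ.image (g ∘ f)) : partWeight (levelCount t f (e a)) =
        AddMonoidAlgebra.single {#{i | (g ∘ f) i = a}} 1 := by
      have hc : levelCount t f (e a) = #{i | (g ∘ f) i = a} := by
        rw [levelCount]
        congr 1
        ext i
        simp [ht, he.eq_iff]
      obtain ⟨i, -, rfl⟩ := mem_image.1 ha
      rw [hc, partWeight, if_neg]
      exact card_ne_zero_of_mem (mem_filter.2 ⟨mem_univ i, rfl⟩)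
    rw [prod_congr rfl h, AddMonoidAlgebra.prod_single, prod_const_one]
    congr 1
    exact (congrArg Multiset.sum (Multiset.map_map _ _ _).symm).trans
      (Multiset.sum_map_singleton _)
  · rw [levelCount, card_eq_zero.2, partWeight_zero]
    rw [filter_eq_empty_iff]
    rintro i - rfl
    exact hu (mem_image.2 ⟨g (f i), mem_image.2 ⟨i, mem_univ i, rfl⟩, (ht _).symm⟩)

open scoped Classical in
theorem levelSum_partWeight {ι α : Type*} [Fintype ι] [DecidableEq α] {k N : ℕ} (t : ι → ℕ)
    (g : ι → α) {e : α → ℕ} (he : Function.Injective e) (ht : ∀ x, t x = e (g x))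
    (hN : ∀ x, t x < N) (Q : (Fin k → ι) → Prop) :
    levelSum partWeight t Q N =
      ∑ f with Monotone (t ∘ f) ∧ Q f, AddMonoidAlgebra.single (seqType (g ∘ f)) 1 := by
  rw [levelSum]
  refine sum_congr ?_ fun f _ => prod_partWeight_levelCount t g he ht f fun _ => hN _
  ext f
  simp [hN]

/-- The type of a sequence of length `m` as a partition of `m`. -/
def seqPartition {m : ℕ} (f : Fin m → ℕ) : m.Partition where
  parts := seqType f
  parts_pos hi := Nat.pos_of_ne_zero fun h => zero_notMem_seqType f (h ▸ hi)
  parts_sum := sum_seqType f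

/-- With values at most `m`, the lower bound in the last position forces the last entry to be `m`.
-/
theorem mem_catalanSeqs_comp_val_iff {m : ℕ} (f : Fin m → Fin (m + 1)) :
    Fin.val ∘ f ∈ catalanSeqs m ↔ Monotone (Fin.val ∘ f) ∧ ∀ i : Fin m, (i : ℕ) + 1 ≤ f i := by
  constructor
  · rintro ⟨h₁, -, h₂, h₃⟩
    refine ⟨h₁, fun i => ?_⟩
    rcases (Nat.succ_le_of_lt i.isLt).eq_or_lt with h | h
    · exact h.le.trans (h₃ i h).ge
    · exact h₂ i h
  · rintro ⟨h₁, h₂⟩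
    refine ⟨h₁, fun i => (Nat.succ_pos _).trans_le (h₂ i), fun i _ => h₂ i, fun i hi => ?_⟩
    have := h₂ i
    have := (f i).isLt
    simp only [Function.comp_apply]
    omega

theorem refinedCatalan_eq_card {m : ℕ} (ν : m.Partition)
    [DecidablePred fun f : Fin m → Fin (m + 1) =>
      Fin.val ∘ f ∈ catalanSeqs m ∧ seqPartition (Fin.val ∘ f) = ν] :
    refinedCatalan ν =
      #{f : Fin m → Fin (m + 1) |
        Fin.val ∘ f ∈ catalanSeqs m ∧ seqPartition (Fin.val ∘ f) = ν} := by
  rw [← Set.ncard_coe_finset, refinedCatalan,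
    ← Set.ncard_image_of_injective _ (Fin.val_injective.comp_left)]
  congr 1
  ext f
  simp only [Set.mem_ofPred_eq, coe_filter, mem_univ, true_and, Set.mem_image]
  constructor
  · rintro ⟨hf, hν⟩
    have hle (i : Fin m) : f i < m + 1 := by
      have hm : m - 1 < m := Nat.sub_lt (Nat.zero_lt_of_lt i.isLt) one_pos
      have h₁ : f i ≤ f ⟨m - 1, hm⟩ := hf.1 (Fin.le_def.2 (Nat.le_sub_one_of_lt i.isLt))
      have h₂ := hf.2.2.2 ⟨m - 1, hm⟩ (Nat.sub_add_cancel (Nat.zero_lt_of_lt i.isLt))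
      omega
    exact ⟨fun i => ⟨f i, hle i⟩, ⟨hf, Nat.Partition.ext hν⟩, rfl⟩
  · rintro ⟨f, ⟨hf, rfl⟩, rfl⟩
    exact ⟨hf, rfl⟩

/-- A tree with `m` edges is a forest of one tree with `m + 1` vertices, which is `levelSum_catalan`
for `m` entries below `m + 1`. -/
theorem treeWeight_partWeight (m : ℕ) :
    treeWeight partWeight 0 m =
      ∑ ν : m.Partition, AddMonoidAlgebra.single ν.parts (refinedCatalan ν) := by
  classical
  have h := levelSum_catalan partWeight partWeight_zero (le_refl (m + 1)) (Nat.le_succ m)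
  rw [Nat.succ_sub (le_refl m), Nat.sub_self] at h
  rw [treeWeight_zero_left, ← h,
    levelSum_partWeight Fin.val Fin.val (e := id) Function.injective_id (fun _ => rfl)
      (fun x => x.isLt),
    ← sum_fiberwise _ fun f : Fin m → Fin (m + 1) => seqPartition (Fin.val ∘ f)]
  refine sum_congr rfl fun ν _ => ?_
  rw [filter_filter, refinedCatalan_eq_card]
  refine (sum_congr (s₂ := {f : Fin m → Fin (m + 1) |
    Fin.val ∘ f ∈ catalanSeqs m ∧ seqPartition (Fin.val ∘ f) = ν})
    (g := fun _ => AddMonoidAlgebra.single ν.parts 1) ?_ fun f hf => ?_).trans ?_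
  · ext f
    simp [mem_catalanSeqs_comp_val_iff]
  · rw [← (mem_filter.1 hf).2.2]
    rfl
  · simp

theorem ncard_primitiveFactorizations {n k : ℕ} (π : Equiv.Perm (Fin n)) (lam : k.Partition) :
    (primitiveFactorizations π lam).ncard =
      (levelSum partWeight (fun x => (x.2 : ℕ))
        (IsOrientedFactorization π : (Fin k → Fin n × Fin n) → Prop) n).coeff lam.parts := by
  classical
  rw [levelSum_partWeight _ Prod.snd Fin.val_injective (fun _ => rfl) (fun x => x.2.isLt),
    AddMonoidAlgebra.coeff_sum, Finsupp.finsetSum_apply]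
  simp only [AddMonoidAlgebra.coeff_single, Finsupp.single_apply]
  rw [← card_filter, filter_filter, ← Set.ncard_coe_finset]
  congr 1
  ext f
  rw [mem_coe, mem_filter]
  constructor
  · rintro ⟨⟨h₁, h₂, h₃⟩, h₄⟩
    exact ⟨mem_univ f, ⟨h₂, h₁, h₃⟩, h₄⟩
  · rintro ⟨-, ⟨h₂, h₁, h₃⟩, h₄⟩
    exact ⟨⟨h₁, h₂, h₃⟩, h₄⟩

/-- Expanding the product chooses a partition of each `μ_i`; exponents add as multisets, so the
coefficient at `lam.parts` selects the refinements. -/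
theorem coeff_cycleWeight {n k : ℕ} (π : Equiv.Perm (Fin n)) (mu lam : k.Partition)
    (hmu : mu.parts = reducedCycleType π) :
    (cycleWeight (treeWeight partWeight 0) π).coeff lam.parts =
      ∑ nu ∈ refinements lam mu, ∏ i, refinedCatalan (nu i) := by
  have h : cycleWeight (treeWeight partWeight 0) π =
      ∏ i : Fin (sortedParts mu).length, treeWeight partWeight 0 ((sortedParts mu).get i) := by
    have h₁ : cycleWeight (treeWeight partWeight 0) π =
        (mu.parts.map (treeWeight partWeight 0)).prod := by
      rw [cycleWeight, hmu, reducedCycleType, Multiset.map_map]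
      rfl
    rw [h₁, ← Multiset.sort_eq mu.parts (· ≥ ·), Multiset.map_coe, Multiset.prod_coe]
    exact (Fin.prod_univ_fun_getElem _ _).symm
  rw [h]
  simp_rw [treeWeight_partWeight]
  rw [prod_univ_sum]
  simp_rw [AddMonoidAlgebra.prod_single]
  rw [AddMonoidAlgebra.coeff_sum, Finsupp.finsetSum_apply, refinements, sum_filter,
    Fintype.piFinset_univ]
  simp only [AddMonoidAlgebra.coeff_single, Finsupp.single_apply]

end Types

theorem theorem1 {n k : ℕ} (π : Equiv.Perm (Fin n)) (mu lam : k.Partition)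
    (hmu : mu.parts = reducedCycleType π) :
    IsLeast (factorizationLengths π) k ∧
    (primitiveFactorizations π lam).ncard =
      ∑ nu ∈ refinements lam mu, ∏ i, refinedCatalan (nu i) := by
  have hk : reducedLength π = k := by
    rw [← mu.parts_sum, hmu]
    rfl
  refine ⟨⟨?_, ?_⟩, ?_⟩
  · obtain ⟨l, h₁, h₂, h₃⟩ := exists_swap_factorization π
    exact ⟨l, h₁.trans hk, h₂, h₃⟩
  · rintro m ⟨l, rfl, h₁, rfl⟩
    exact hk ▸ reducedLength_prod_le h₁
  · rw [ncard_primitiveFactorizations,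
      levelSum_factorization partWeight partWeight_zero le_rfl
        (fun x hx => absurd x.isLt hx.not_gt) hk,
      coeff_cycleWeight π mu lam hmu]
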